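/- Let $\{k_n, n\ge 1\}$ be a sequence of positive integers, $\{X_{n,i}, 1\le i\le k_n, n\ge1\}$ an array of real random variables on a probability space, and $\{a_{n,i}, 1\le i\le k_n, n\ge 1\}$ an array of nonnegative real numbers with $\sup_{n\ge1}\sum_{i=1}^{k_n}a_{n,i}=C_0\in(0,\infty)$. The array $\{X_{n,i}\}$ is called $\{a_{n,i}\}$-stochastically dominated by a random variable $X$ (possibly on another probability space) if $\sup_{n\ge1}\sum_{i=1}^{k_n}a_{n,i}\mathbb P(|X_{n,i}|>x)\le C_0\,\mathbb P(|X|>x)$ for all $x\in\mathbb R$, and an array $\{Y_{n,i}\}$ is called $\{a_{n,i}\}$-uniformly integrable if $\lim_{t\to\infty}\sup_{n\ge1}\sum_{i=1}^{k_n}a_{n,i}\mathbb E\left(|Y_{n,i}|\mathbf 1(|Y_{n,i}|>t)\right)=0$ (with $0\cdot\infty=0$). A real function $L$ is slowly varying if it is positive and measurable on $[A,\infty)$ for some $A\ge 0$ and $\lim_{x\to\infty}L(\lambda x)/L(x)=1$ for each $\lambda>0$. A de Bruijn conjugate of $L$ is a slowly varying function $\tilde L$ with $\lim_{x\to\infty}L(x)\tilde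 L(xL(x))=1$ and $\lim_{x\to\infty}\tilde L(x)L(x\tilde L(x))=1$. For $x\ge0$ let $\log x$ denote the base $2$ logarithm of $\max\{2,x\}$, and for a positive integer $\nu$ let $\log_\nu^{(2)}(x)=(\log x)(\log\log x)\cdots(\log\cdots\log x)^2$, with $\nu$ factors, the last one squared. Let $p>0$, let $L:[0,\infty)\to\mathbb R$ be a slowly varying function that is measurable and bounded on every bounded subinterval of $[0,\infty)$, and let $\tilde L$ be a de Bruijn conjugate of $L$. (i) If $\{X_{n,i}\}$ is $\{a_{n,i}\}$-stochastically dominated by a random variable $X$ with $\mathbb E\left(|X|^pL(|X|^p)\right)<\infty$ (i.e. $|X|^pL(|X|^p)$ is integrable), then $\{|X_{n,i}|^pL(|X_{n,i}|^p)\}$ is $\{a_{n,i}\}$-uniformly integrable. (ii) If $\{|X_{n,i}|^pL(|X_{n,i}|^p)\}$ is $\{a_{n,i}\}$-uniformly integrable, then there exists a random variable $X$ with distribution function $$F(x)=1-\frac1{C_0}\sup_{n\ge1}\sum_{i=1}^{k_n}a_{n,i}\mathbb P(|X_{n,i}|>x),\qquad x\in\mathbb R,$$ such that $\{X_{n,i}\}$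 is $\{a_{n,i}\}$-stochastically dominated by $X$, $$\mathbb E\left(|X|^pL(|X|^p)\left(\log_\nu^{(2)}(|X|)\right)^{-1}\right)<\infty\quad\text{for every positive integer }\nu$$ (the random variable inside being integrable), and $$\lim_{x\to\infty}x\,\mathbb P\left(|X|>x^{1/p}\tilde L^{1/p}(x)\right)=0.$$ -/

import Mathlib

open MeasureTheory ProbabilityTheory Filter Topology Set

noncomputable section

namespace StochDom

/-- The truncated logarithm in base 2: `log x` is the base 2 logarithm of `max {2, x}`. -/
def tlog (x : ℝ) : ℝ := Real.logb 2 (max 2 x)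

/-- `(log x)(log log x) ⋯ (log ⋯ log x)²` with `ν` factors, the last one squared, where `log` is
the truncated base 2 logarithm `tlog`. It is used for `ν ≥ 1` only. -/
def logProdSq (ν : ℕ) (x : ℝ) : ℝ :=
  (∏ j ∈ Finset.Icc 1 (ν - 1), tlog^[j] x) * (tlog^[ν] x) ^ 2

/-- `L` is slowly varying at infinity: positive and measurable on some half-line `[A, ∞)`, `A ≥ 0`,
with `L (c x) / L x → 1` as `x → ∞` for each `c > 0`. -/
def SlowlyVarying (L : ℝ → ℝ) : Prop :=
  (∃ A : ℝ, 0 ≤ A ∧ (∀ x, A ≤ x → 0 < L x) ∧ Measurable ((Ici A).domRestrict L)) ∧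
    ∀ c : ℝ, 0 < c → Tendsto (fun x => L (c * x) / L x) atTop (𝓝 1)

/-- `M` is a de Bruijn conjugate of `L` (it is determined up to asymptotic equivalence). -/
def IsDeBruijnConjugate (L M : ℝ → ℝ) : Prop :=
  SlowlyVarying M ∧
    Tendsto (fun x => L x * M (x * L x)) atTop (𝓝 1) ∧
    Tendsto (fun x => M x * L (x * M x)) atTop (𝓝 1)

/-- `sup_n ∑_i a_{n,i} P(|X_{n,i}| > x)`. -/
def tailSup {Ω : Type*} [MeasurableSpace Ω] (P : Measure Ω) {k : ℕ → ℕ}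
    (a : (n : ℕ) → Fin (k n) → ℝ) (X : (n : ℕ) → Fin (k n) → Ω → ℝ) (x : ℝ) : ℝ :=
  ⨆ n, ∑ i, a n i * P.real {ω | x < |X n i ω|}

/-- The array `X` is `{a_{n,i}}`-stochastically dominated by the random variable `Y`; here `C₀` is
`sup_n ∑_i a_{n,i}`. The random variable `Y` may live on another probability space. -/
def StochasticallyDominated {Ω Ω' : Type*} [MeasurableSpace Ω] [MeasurableSpace Ω']
    (P : Measure Ω) (P' : Measure Ω') {k : ℕ → ℕ} (a : (n : ℕ) → Fin (k n) → ℝ) (C₀ : ℝ)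
    (X : (n : ℕ) → Fin (k n) → Ω → ℝ) (Y : Ω' → ℝ) : Prop :=
  ∀ x : ℝ, tailSup P a X x ≤ C₀ * P'.real {ω | x < |Y ω|}

/-- The array `X` is `{a_{n,i}}`-uniformly integrable:
`sup_n ∑_i a_{n,i} E(|X_{n,i}| 1(|X_{n,i}| > t)) → 0` as `t → ∞`. Expectations of nonnegative random
variables are taken in `[0, ∞]`, with `0 · ∞ = 0`. -/
def UniformlyIntegrable {Ω : Type*} [MeasurableSpace Ω] (P : Measure Ω) {k : ℕ → ℕ}
    (a : (n : ℕ) → Fin (k n) → ℝ) (X : (n : ℕ) → Fin (k n) → Ω → ℝ) : Prop :=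
  Tendsto (fun t : ℝ => ⨆ n, ∑ i, ENNReal.ofReal (a n i) *
    ∫⁻ ω in {ω | t < |X n i ω|}, ENNReal.ofReal |X n i ω| ∂P) atTop (𝓝 0)

end StochDom

end

namespace StochDom

/-! Write `h y = y * L y` and `T = tailSup P a X`. The uniform convergence theorem yields Potter's
bound, so eventually `h` is increasing up to a factor 2, tends to infinity and grows boundedly under
dilations.

For (i), beyond a threshold `h` lies within a factor 2 of a monotone function, and domination of
tails passes to integrals of monotone functions; the truncated sums are bounded by a tail of the
integral of `h (|Y| ^ p)`.

For (ii), a Markov argument gives `h (x ^ p) * T x → 0`, hence `T → 0`. Then `1 - T / C₀` is the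
distribution function of a law on `[0, ∞)` (`exists_measure_of_tailSup`), for which domination is an
equality. The tail bound gives integrability by dyadic summation against `logProdSq`, and the de
Bruijn limit by a change of variable. -/

/-! ### Slowly varying functions -/

/-- Uniform convergence theorem, additive form. -/
theorem uniform_of_tendsto_shift_sub {f : ℝ → ℝ} (hf : Measurable f)
    (h : ∀ u : ℝ, Tendsto (fun t => f (t + u) - f t) atTop (𝓝 0)) {ε : ℝ} (hε : 0 < ε) :
    ∃ T : ℝ, ∀ t, T ≤ t → ∀ u ∈ Icc (0 : ℝ) 1, |f (t + u) - f t| ≤ ε := by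
  -- Truncation at 1 permits dominated convergence. The window has length 2 so that it contains `[0,
  -- 1]` shifted by any `u ∈ [0, 1]`.
  set φ : ℝ → ℝ := fun t => ∫ v in Icc (0 : ℝ) 2, min 1 |f (t + v) - f t| with hφ
  have hmeas : ∀ t : ℝ, Measurable fun v => min (1 : ℝ) |f (t + v) - f t| := fun t =>
    measurable_const.min
      (continuous_abs.measurable.comp ((hf.comp (measurable_const_add t)).sub_const _))
  have hbound : ∀ t v : ℝ, ‖min (1 : ℝ) |f (t + v) - f t|‖ ≤ 1 := fun t v => by
    rw [Real.norm_of_nonneg (le_min zero_le_one (abs_nonneg _))]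
    exact min_le_left _ _
  have hint : ∀ t a b : ℝ, IntegrableOn (fun v => min (1 : ℝ) |f (t + v) - f t|) (Icc a b) :=
    fun t a b => Measure.integrableOn_of_bounded (M := 1) (by simp)
      (hmeas t).aestronglyMeasurable (Eventually.of_forall (hbound t))
  have hφ0 : Tendsto φ atTop (𝓝 0) := by
    have : Tendsto φ atTop (𝓝 (∫ _ in Icc (0 : ℝ) 2, (0 : ℝ))) := by
      refine tendsto_integral_filter_of_dominated_convergence (fun _ => (1 : ℝ))
        (Eventually.of_forall fun t => (hmeas t).aestronglyMeasurable)
        (Eventually.of_forall fun t => Eventually.of_forall (hbound t))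
        (integrable_const _) (Eventually.of_forall fun v => ?_)
      have := (tendsto_const_nhds (x := (1 : ℝ))).min (h v).abs
      simpa using this
    simpa using this
  -- Below 1, so that a truncated increment less than `δ` is the true increment.
  set δ : ℝ := min ε (1 / 2) with hδ
  have hδ0 : 0 < δ := lt_min hε (by norm_num)
  obtain ⟨T, hT⟩ := eventually_atTop.1 (hφ0.eventually (gt_mem_nhds (half_pos hδ0)))
  refine ⟨T, fun t ht u hu => ?_⟩
  -- The triangle inequality through `f (t + u + w)`, averaged over `w ∈ [0, 1]`.
  have key : min (1 : ℝ) |f (t + u) - f t| ≤ φ (t + u) + φ t := by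
    have h1 : ∫ w in Icc (0 : ℝ) 1, min (1 : ℝ) |f (t + u + w) - f (t + u)| ≤ φ (t + u) :=
      setIntegral_mono_set (hint _ _ _)
        (Eventually.of_forall fun w => le_min zero_le_one (abs_nonneg _))
        (Icc_subset_Icc le_rfl (by norm_num)).eventuallyLE
    have h2 : ∫ w in Icc (0 : ℝ) 1, min (1 : ℝ) |f (t + (w + u)) - f t| ≤ φ t := by
      have hshift : ∫ w in Icc (0 : ℝ) 1, min (1 : ℝ) |f (t + (w + u)) - f t| =
          ∫ v in Icc u (1 + u), min (1 : ℝ) |f (t + v) - f t| := by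
        have := (measurePreserving_add_right volume u).setIntegral_preimage_emb
          (measurableEmbedding_addRight u) (fun v => min (1 : ℝ) |f (t + v) - f t|)
          (Icc u (1 + u))
        rw [← this]
        congr 2
        ext w
        simp
      rw [hshift]
      exact setIntegral_mono_set (hint _ _ _)
        (Eventually.of_forall fun w => le_min zero_le_one (abs_nonneg _))
        (Icc_subset_Icc hu.1 (by linarith [hu.2])).eventuallyLE
    have hint' : IntegrableOn (fun w => min (1 : ℝ) |f (t + (w + u)) - f t|) (Icc (0 : ℝ) 1) :=
      Measure.integrableOn_of_bounded (M := 1) (by simp)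
        ((hmeas t).comp (measurable_add_const u)).aestronglyMeasurable
        (Eventually.of_forall fun w => hbound t (w + u))
    have h3 : ∫ _ in Icc (0 : ℝ) 1, min (1 : ℝ) |f (t + u) - f t| ≤
        ∫ w in Icc (0 : ℝ) 1, (min (1 : ℝ) |f (t + u + w) - f (t + u)| +
          min (1 : ℝ) |f (t + (w + u)) - f t|) := by
      refine integral_mono (integrable_const _) ((hint _ _ _).add hint') fun w => ?_
      have e : t + (w + u) = t + u + w := by ring
      simp only [e]
      have htri : |f (t + u) - f t| ≤
          |f (t + u + w) - f (t + u)| + |f (t + u + w) - f t| := by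
        rw [abs_sub_comm (f (t + u + w)) (f (t + u))]
        exact abs_sub_le _ _ _
      rcases le_total 1 |f (t + u + w) - f (t + u)| with h1 | h1
      · rw [min_eq_left h1]
        exact (min_le_left _ _).trans
          (le_add_of_nonneg_right (le_min zero_le_one (abs_nonneg _)))
      rcases le_total 1 |f (t + u + w) - f t| with h2 | h2
      · rw [min_eq_left h2]
        exact (min_le_left _ _).trans
          (le_add_of_nonneg_left (le_min zero_le_one (abs_nonneg _)))
      · rw [min_eq_right h1, min_eq_right h2]
        exact (min_le_right _ _).trans htri
    rw [integral_add (hint _ _ _) hint'] at h3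
    simp only [integral_const, MeasurableSet.univ, measureReal_restrict_apply, univ_inter,
      Real.volume_real_Icc, sub_zero, smul_eq_mul] at h3
    norm_num at h3
    rcases h3 with h3 | h3
    · linarith [min_le_left (1 : ℝ) |f (t + u) - f t|]
    · exact (min_le_right _ _).trans (by linarith)
  have hlt : min (1 : ℝ) |f (t + u) - f t| < δ := by
    have := hT t ht
    have := hT (t + u) (by linarith [hu.1])
    linarith
  rcases min_lt_iff.1 hlt with h1 | h1
  · exact absurd (h1.trans_le (min_le_right _ _)) (by norm_num)
  · exact h1.le.trans (min_le_left _ _)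

/-- Chain `⌊u⌋₊` unit steps and one fractional step, which accounts for the `+ 1`. -/
theorem abs_shift_sub_le {f : ℝ → ℝ} {T ε : ℝ}
    (h : ∀ t, T ≤ t → ∀ u ∈ Icc (0 : ℝ) 1, |f (t + u) - f t| ≤ ε) (hε : 0 ≤ ε) {t u : ℝ}
    (ht : T ≤ t) (hu : 0 ≤ u) : |f (t + u) - f t| ≤ ε * (u + 1) := by
  have aux : ∀ n : ℕ, ∀ t, T ≤ t → |f (t + n) - f t| ≤ ε * n := by
    intro n
    induction n with
    | zero => simp
    | succ n ih =>
      intro t ht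
      have h1 := h (t + n) (by have : (0 : ℝ) ≤ n := n.cast_nonneg; linarith) 1 (by simp)
      have h2 := ih t ht
      have h3 := abs_sub_le (f (t + n + 1)) (f (t + n)) (f t)
      push_cast
      rw [← add_assoc]
      linarith
  have h1 := aux ⌊u⌋₊ t ht
  have hfl := Nat.floor_le hu
  have hfl' := Nat.lt_floor_add_one u
  have h2 := h (t + ⌊u⌋₊) (by have : (0 : ℝ) ≤ ⌊u⌋₊ := Nat.cast_nonneg _; linarith)
    (u - ⌊u⌋₊) ⟨by linarith, by linarith⟩
  have e : t + ⌊u⌋₊ + (u - ⌊u⌋₊) = t + u := by ring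
  rw [e] at h2
  have h3 := abs_sub_le (f (t + u)) (f (t + ⌊u⌋₊)) (f t)
  nlinarith

/-- Potter's bound: in the coordinate `t = log x`, slow variation says that increments of `log L`
tend to 0. The slope `1 / 2` is below 1, so the factor `x` in `x * L x` prevails. -/
theorem SlowlyVarying.potter {L : ℝ → ℝ} (hL : SlowlyVarying L) :
    ∃ B : ℝ, 0 < B ∧ (∀ x, B ≤ x → 0 < L x) ∧
      ∀ x y, B ≤ x → x ≤ y →
        |Real.log (L y) - Real.log (L x)| ≤ 1 / 2 * (Real.log y - Real.log x + 1) := by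
  obtain ⟨⟨A, hA, hpos, hmeas⟩, hlim⟩ := hL
  set f : ℝ → ℝ := fun t => Real.log (L (max A (Real.exp t))) with hf
  have hfm : Measurable f := by
    have h1 : Measurable fun t : ℝ => (⟨max A (Real.exp t), mem_Ici.2 (le_max_left _ _)⟩ : Ici A) :=
      (measurable_const.max Real.measurable_exp).subtype_mk
    exact Real.measurable_log.comp (hmeas.comp h1)
  have hlarge : ∀ᶠ t in atTop, A ≤ Real.exp t := Real.tendsto_exp_atTop.eventually_ge_atTop A
  have hshift : ∀ u : ℝ, Tendsto (fun t => f (t + u) - f t) atTop (𝓝 0) := by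
    intro u
    have h1 := ((hlim (Real.exp u) (Real.exp_pos u)).comp Real.tendsto_exp_atTop).log one_ne_zero
    rw [Real.log_one] at h1
    refine h1.congr' ?_
    filter_upwards [hlarge, (tendsto_atTop_add_const_right atTop u tendsto_id).eventually hlarge]
      with t ht htu
    simp only [id] at htu
    simp only [hf, Function.comp, max_eq_right ht, max_eq_right htu]
    rw [← Real.exp_add, add_comm u t,
      Real.log_div (hpos _ htu).ne' (hpos _ ht).ne']
  obtain ⟨T, hT⟩ := uniform_of_tendsto_shift_sub hfm hshift (ε := 1 / 2) (by norm_num)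
  refine ⟨max A (Real.exp T), lt_max_of_lt_right (Real.exp_pos T),
    fun x hx => hpos x ((le_max_left _ _).trans hx), fun x y hx hxy => ?_⟩
  have hx0 : 0 < x := (Real.exp_pos T).trans_le ((le_max_right _ _).trans hx)
  have hy0 : 0 < y := hx0.trans_le hxy
  have hAx : A ≤ x := (le_max_left _ _).trans hx
  have hTx : T ≤ Real.log x := (Real.le_log_iff_exp_le hx0).2 ((le_max_right _ _).trans hx)
  have := abs_shift_sub_le hT (by norm_num) hTx (sub_nonneg.2 (Real.log_le_log hx0 hxy))
  simp only [hf, add_sub_cancel, Real.exp_log hx0, Real.exp_log hy0, max_eq_right hAx,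
    max_eq_right (hAx.trans hxy)] at this
  exact this

/-- If `L` is slowly varying then `x ↦ x L(x)` is, eventually, increasing up to a constant factor,
tends to infinity, and grows by a bounded factor over `[x, c x]`. -/
theorem SlowlyVarying.exists_almost_monotone {L : ℝ → ℝ} (hL : SlowlyVarying L) :
    ∃ B : ℝ, 0 < B ∧ (∀ x, B ≤ x → 0 < L x) ∧
      (∀ x y, B ≤ x → x ≤ y → x * L x ≤ 2 * (y * L y)) ∧
      Tendsto (fun x => x * L x) atTop atTop ∧
      ∀ c : ℝ, 0 < c → ∃ K : ℝ, 0 < K ∧ ∀ x y, B ≤ x → x ≤ y → y ≤ c * x →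
        y * L y ≤ K * (x * L x) := by
  obtain ⟨B, hB, hpos, hpot⟩ := hL.potter
  have hexp : ∀ x, B ≤ x → x * L x = Real.exp (Real.log x + Real.log (L x)) := fun x hx => by
    rw [Real.exp_add, Real.exp_log (hB.trans_le hx), Real.exp_log (hpos x hx)]
  refine ⟨B, hB, hpos, fun x y hx hxy => ?_, ?_, fun c hc => ?_⟩
  · have h1 := abs_le.1 (hpot x y hx hxy)
    have h2 := Real.log_le_log (hB.trans_le hx) hxy
    have h3 (z : ℝ) : 2 * Real.exp z = Real.exp (Real.log 2 + z) := by
      rw [Real.exp_add, Real.exp_log two_pos]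
    rw [hexp x hx, hexp y (hx.trans hxy), h3]
    refine Real.exp_le_exp.2 ?_
    -- Potter's bound loses at most `exp (1 / 2)`, which is below 2.
    linarith [h1.1, Real.log_two_gt_d9]
  · have h1 : Tendsto (fun x => Real.exp (1 / 2 * Real.log x +
        (1 / 2 * Real.log B + Real.log (L B) - 1 / 2))) atTop atTop :=
      Real.tendsto_exp_atTop.comp (tendsto_atTop_add_const_right _ _
        (Real.tendsto_log_atTop.const_mul_atTop (by norm_num)))
    refine tendsto_atTop_mono' _ ?_ h1
    filter_upwards [eventually_ge_atTop B] with x hx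
    rw [hexp x hx]
    refine Real.exp_le_exp.2 ?_
    linarith [(abs_le.1 (hpot B x le_rfl hx)).1]
  · refine ⟨Real.exp (3 / 2 * Real.log c + 1 / 2), Real.exp_pos _, fun x y hx hxy hyc => ?_⟩
    have hx0 := hB.trans_le hx
    have h1 := (abs_le.1 (hpot x y hx hxy)).2
    have h2 := Real.log_le_log (hx0.trans_le hxy) hyc
    rw [Real.log_mul hc.ne' hx0.ne'] at h2
    rw [hexp x hx, hexp y (hx.trans hxy), ← Real.exp_add]
    refine Real.exp_le_exp.2 ?_
    linarith

/-- The function `g` is the running supremum of `u * L u` over `[s, y]`; almost monotonicity bounds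
it. In `ENNReal` the empty supremum is 0, which gives the cutoff below `s`. -/
theorem SlowlyVarying.exists_monotone_comparable {L : ℝ → ℝ} (hL : SlowlyVarying L) :
    ∃ B : ℝ, ∀ s, B ≤ s → ∃ g : ℝ → ℝ, Monotone g ∧ (∀ y, 0 ≤ g y) ∧ (∀ y, y < s → g y = 0) ∧
      ∀ y, s ≤ y → 0 < y * L y ∧ y * L y ≤ g y ∧ g y ≤ 2 * (y * L y) := by
  obtain ⟨B, hB, hpos, hmono, -, -⟩ := hL.exists_almost_monotone
  refine ⟨B, fun s hs => ?_⟩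
  have hh : ∀ y, s ≤ y → 0 < y * L y := fun y hy =>
    mul_pos (hB.trans_le (hs.trans hy)) (hpos y (hs.trans hy))
  set G : ℝ → ENNReal := fun y => ⨆ u ∈ Icc s y, ENNReal.ofReal (u * L u) with hG
  have hG0 : ∀ y, y < s → G y = 0 := fun y hy => by
    simp only [hG, Icc_eq_empty_of_lt hy, mem_empty_iff_false, iSup_false, iSup_bot]
    rfl
  have hGle : ∀ y, s ≤ y → G y ≤ ENNReal.ofReal (2 * (y * L y)) := fun y _ =>
    iSup₂_le fun u hu => ENNReal.ofReal_le_ofReal (hmono u y (hs.trans hu.1) hu.2)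
  have hGtop : ∀ y, G y ≠ ⊤ := fun y => by
    rcases lt_or_ge y s with hy | hy
    · simp [hG0 y hy]
    · exact ((hGle y hy).trans_lt ENNReal.ofReal_lt_top).ne
  refine ⟨fun y => (G y).toReal, fun x y hxy => ENNReal.toReal_mono (hGtop y) ?_,
    fun y => ENNReal.toReal_nonneg, fun y hy => by simp [hG0 y hy], fun y hy => ⟨hh y hy, ?_, ?_⟩⟩
  · exact biSup_mono fun u hu => ⟨hu.1, hu.2.trans hxy⟩
  · refine (ENNReal.ofReal_le_iff_le_toReal (hGtop y)).1 ?_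
    exact le_iSup₂_of_le y ⟨hy, le_rfl⟩ le_rfl
  · exact ENNReal.toReal_le_of_le_ofReal (by linarith [hh y hy]) (hGle y hy)

/-! ### Stochastic order and part (i) -/

/-- A nonempty upper set of the line is an open or closed half-line or everything; the last two
cases follow from the first by continuity of measures. -/
theorem measure_le_of_isUpperSet {μ ν : Measure ℝ} [IsFiniteMeasure μ] [IsFiniteMeasure ν]
    (h : ∀ x, μ (Ioi x) ≤ ν (Ioi x)) {U : Set ℝ} (hU : IsUpperSet U) : μ U ≤ ν U := by
  rcases U.eq_empty_or_nonempty with rfl | hne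
  · simp
  by_cases hb : BddBelow U
  · set m := sInf U
    have hsub : Ioi m ⊆ U := fun y hy => by
      obtain ⟨z, hz, hzy⟩ := (csInf_lt_iff hb hne).1 hy
      exact hU hzy.le hz
    by_cases hm : m ∈ U
    · have e : U = Ici m := Subset.antisymm (fun y hy => csInf_le hb hy) fun y hy => hU hy hm
      have hI : U = ⋂ n : ℕ, Ioi (m - 1 / ((n : ℝ) + 1)) := by
        rw [e]
        ext y
        simp only [mem_Ici, mem_iInter, mem_Ioi]
        refine ⟨fun hy n => ?_, fun hy => ?_⟩
        · have : (0 : ℝ) < 1 / ((n : ℝ) + 1) := Nat.one_div_pos_of_nat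
          linarith
        · by_contra! hlt
          obtain ⟨n, hn⟩ := exists_nat_one_div_lt (sub_pos.2 hlt)
          linarith [hy n]
      have hanti : Antitone fun n : ℕ => Ioi (m - 1 / ((n : ℝ) + 1)) := fun i j hij =>
        Ioi_subset_Ioi (sub_le_sub_left (Nat.one_div_le_one_div hij) _)
      have ht (ρ : Measure ℝ) [IsFiniteMeasure ρ] := tendsto_measure_iInter_atTop (μ := ρ)
        (fun n : ℕ => (measurableSet_Ioi (a := m - 1 / ((n : ℝ) + 1))).nullMeasurableSet) hanti
        ⟨0, measure_ne_top _ _⟩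
      rw [hI]
      exact le_of_tendsto_of_tendsto' (ht μ) (ht ν) fun n => h _
    · have e : U = Ioi m := Subset.antisymm
        (fun y hy => (csInf_le hb hy).lt_of_ne fun e => hm (by rwa [show m = y from e])) hsub
      rw [e]
      exact h m
  · have hI : U = ⋃ n : ℕ, Ioi (-(n : ℝ)) := by
      refine Subset.antisymm (fun y _ => ?_) fun y _ => ?_
      · obtain ⟨n, hn⟩ := exists_nat_gt (-y)
        exact mem_iUnion.2 ⟨n, by simp only [mem_Ioi]; linarith⟩
      · obtain ⟨z, hz, hzy⟩ := not_bddBelow_iff.1 hb y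
        exact hU hzy.le hz
    have hmono : Monotone fun n : ℕ => Ioi (-(n : ℝ)) := fun i j hij =>
      Ioi_subset_Ioi (neg_le_neg (Nat.cast_le.2 hij))
    rw [hI]
    exact le_of_tendsto_of_tendsto' (tendsto_measure_iUnion_atTop (μ := μ) hmono)
      (tendsto_measure_iUnion_atTop (μ := ν) hmono) fun n => h _

/-- Layer cake formula: superlevel sets of a monotone function are upper sets. -/
theorem lintegral_monotone_le {μ ν : Measure ℝ} [IsFiniteMeasure μ] [IsFiniteMeasure ν]
    (h : ∀ x, μ (Ioi x) ≤ ν (Ioi x)) {φ : ℝ → ℝ} (hφ : Monotone φ) (hφ0 : ∀ x, 0 ≤ φ x) :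
    ∫⁻ x, ENNReal.ofReal (φ x) ∂μ ≤ ∫⁻ x, ENNReal.ofReal (φ x) ∂ν := by
  rw [lintegral_eq_lintegral_meas_lt μ (Eventually.of_forall hφ0) hφ.measurable.aemeasurable,
    lintegral_eq_lintegral_meas_lt ν (Eventually.of_forall hφ0) hφ.measurable.aemeasurable]
  exact lintegral_mono fun t =>
    measure_le_of_isUpperSet h fun x y hxy (hx : t < φ x) => hx.trans_le (hφ hxy)

theorem tailSup_nonneg {Ω : Type*} [MeasurableSpace Ω] {P : Measure Ω} {k : ℕ → ℕ}
    {X : (n : ℕ) → Fin (k n) → Ω → ℝ} {a : (n : ℕ) → Fin (k n) → ℝ} (ha : ∀ n i, 0 ≤ a n i)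
    (x : ℝ) : 0 ≤ tailSup P a X x :=
  Real.iSup_nonneg fun n => Finset.sum_nonneg fun i _ => mul_nonneg (ha n i) measureReal_nonneg

section Array

variable {Ω : Type*} [MeasurableSpace Ω] {P : Measure Ω} [IsProbabilityMeasure P] {k : ℕ → ℕ}
  {X : (n : ℕ) → Fin (k n) → Ω → ℝ} {a : (n : ℕ) → Fin (k n) → ℝ} {C₀ : ℝ}

theorem sum_mul_measureReal_le (ha : ∀ n i, 0 ≤ a n i) (hC : ∀ n, ∑ i, a n i ≤ C₀) (x : ℝ)
    (n : ℕ) : ∑ i, a n i * P.real {ω | x < |X n i ω|} ≤ C₀ :=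
  (Finset.sum_le_sum fun i _ => mul_le_of_le_one_right (ha n i) measureReal_le_one).trans (hC n)

theorem bddAbove_tail (ha : ∀ n i, 0 ≤ a n i) (hC : ∀ n, ∑ i, a n i ≤ C₀) (x : ℝ) :
    BddAbove (range fun n => ∑ i, a n i * P.real {ω | x < |X n i ω|}) :=
  ⟨C₀, forall_mem_range.2 (sum_mul_measureReal_le ha hC x)⟩

theorem sum_le_tailSup (ha : ∀ n i, 0 ≤ a n i) (hC : ∀ n, ∑ i, a n i ≤ C₀) (x : ℝ) (n : ℕ) :
    ∑ i, a n i * P.real {ω | x < |X n i ω|} ≤ tailSup P a X x :=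
  le_ciSup (bddAbove_tail ha hC x) n

theorem StochasticallyDominated.sum_lintegral_le {Ω' : Type*} [MeasurableSpace Ω']
    {P' : Measure Ω'} [IsProbabilityMeasure P'] {Y : Ω' → ℝ}
    (hdom : StochasticallyDominated P P' a C₀ X Y) (hX : ∀ n i, Measurable (X n i))
    (ha : ∀ n i, 0 ≤ a n i) (hC₀ : 0 ≤ C₀) (hC : ∀ n, ∑ i, a n i ≤ C₀) (hY : Measurable Y)
    {φ : ℝ → ℝ} (hφ : Monotone φ) (hφ0 : ∀ x, 0 ≤ φ x) (n : ℕ) :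
    ∑ i, ENNReal.ofReal (a n i) * ∫⁻ ω, ENNReal.ofReal (φ |X n i ω|) ∂P ≤
      ENNReal.ofReal C₀ * ∫⁻ ω, ENNReal.ofReal (φ |Y ω|) ∂P' := by
  have hXm : ∀ i, Measurable fun ω => |X n i ω| := fun i => (hX n i).abs
  have hYm : Measurable fun ω => |Y ω| := hY.abs
  have hφm : Measurable fun x => ENNReal.ofReal (φ x) := hφ.measurable.ennreal_ofReal
  -- The weighted row becomes a single finite measure, so that domination compares two measures on
  -- half-lines.
  set μ : Measure ℝ := ∑ i, (a n i).toNNReal • P.map (fun ω => |X n i ω|) with hμ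
  set ν : Measure ℝ := C₀.toNNReal • P'.map (fun ω => |Y ω|) with hν
  have key : ∫⁻ x, ENNReal.ofReal (φ x) ∂μ ≤ ∫⁻ x, ENNReal.ofReal (φ x) ∂ν := by
    refine lintegral_monotone_le (fun x => ?_) hφ hφ0
    have h1 := (sum_le_tailSup (P := P) (X := X) ha hC x n).trans (hdom x)
    have h2 := ENNReal.ofReal_le_ofReal h1
    rw [ENNReal.ofReal_sum_of_nonneg fun i _ => mul_nonneg (ha n i) measureReal_nonneg,
      ENNReal.ofReal_mul hC₀] at h2
    simp only [ENNReal.ofReal_mul (ha n _), measureReal_def,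
      ENNReal.ofReal_toReal (measure_ne_top _ _)] at h2
    simp only [hμ, hν, Measure.finsetSum_apply, Measure.smul_apply,
      Measure.map_apply (hXm _) measurableSet_Ioi, Measure.map_apply hYm measurableSet_Ioi]
    exact h2
  simp only [hμ, hν, lintegral_finsetSum_measure, lintegral_smul_measure,
    lintegral_map hφm (hXm _), lintegral_map hφm hYm] at key
  exact key

theorem StochasticallyDominated.uniformlyIntegrable {Ω' : Type*} [MeasurableSpace Ω']
    {P' : Measure Ω'} [IsProbabilityMeasure P'] {Y : Ω' → ℝ}
    (hdom : StochasticallyDominated P P' a C₀ X Y) (hX : ∀ n i, Measurable (X n i))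
    (ha : ∀ n i, 0 ≤ a n i) (hC₀ : 0 ≤ C₀) (hC : ∀ n, ∑ i, a n i ≤ C₀) (hY : Measurable Y)
    {p : ℝ} (hp : 0 < p) {L : ℝ → ℝ} (hL : SlowlyVarying L)
    (hLbdd : ∀ B : ℝ, ∃ M : ℝ, ∀ x ∈ Icc 0 B, |L x| ≤ M)
    (hint : Integrable (fun ω => |Y ω| ^ p * L (|Y ω| ^ p)) P') :
    UniformlyIntegrable P a (fun n i ω => |X n i ω| ^ p * L (|X n i ω| ^ p)) := by
  obtain ⟨B, hB⟩ := hL.exists_monotone_comparable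
  have hdct : Tendsto (fun s : ℝ => ENNReal.ofReal C₀ * (2 * ∫⁻ ω,
      {ω | s ≤ |Y ω| ^ p}.indicator
        (fun ω => ENNReal.ofReal |(|Y ω| ^ p * L (|Y ω| ^ p))|) ω ∂P')) atTop (𝓝 0) := by
    have h0 : Tendsto (fun s : ℝ => ∫⁻ ω, {ω | s ≤ |Y ω| ^ p}.indicator
        (fun ω => ENNReal.ofReal |(|Y ω| ^ p * L (|Y ω| ^ p))|) ω ∂P') atTop
        (𝓝 (∫⁻ _, 0 ∂P')) := by
      refine tendsto_lintegral_filter_of_dominated_convergence'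
        (fun ω => ENNReal.ofReal |(|Y ω| ^ p * L (|Y ω| ^ p))|)
        (Eventually.of_forall fun s => ?_)
        (Eventually.of_forall fun s => Eventually.of_forall fun ω => ?_) ?_
        (Eventually.of_forall fun ω => ?_)
      · exact (hint.aestronglyMeasurable.aemeasurable.abs.ennreal_ofReal).indicator
          (measurableSet_le measurable_const (hY.abs.pow_const p))
      · exact indicator_le_self _ _ _
      · have := hint.hasFiniteIntegral
        rw [hasFiniteIntegral_iff_norm] at this
        exact this.ne
      · refine tendsto_const_nhds.congr' ?_
        filter_upwards [eventually_gt_atTop (|Y ω| ^ p)] with s hs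
        rw [indicator_of_notMem]
        simpa using hs
    have h1 := ENNReal.Tendsto.const_mul (a := 2) h0 (Or.inr ENNReal.ofNat_ne_top)
    have h2 := ENNReal.Tendsto.const_mul (a := ENNReal.ofReal C₀) h1
      (Or.inr ENNReal.ofReal_ne_top)
    simpa using h2
  refine ENNReal.tendsto_nhds_zero.2 fun ε hε => ?_
  obtain ⟨s, hs0, hsB, hsε⟩ := ((eventually_ge_atTop (0 : ℝ)).and
    ((eventually_ge_atTop B).and (ENNReal.tendsto_nhds_zero.1 hdct ε hε))).exists
  obtain ⟨g, hgm, hg0, hgs, hg⟩ := hB s hsB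
  obtain ⟨M, hM⟩ := hLbdd s
  -- The `max` makes `φ` monotone on all of `ℝ`, negative bases included.
  set φ : ℝ → ℝ := fun x => g (max x 0 ^ p) with hφ
  have hφm : Monotone φ := fun x y hxy => hgm
    (Real.rpow_le_rpow (le_max_right _ _) (max_le_max_right 0 hxy) hp.le)
  have hφabs : ∀ x : ℝ, φ |x| = g (|x| ^ p) := fun x => by simp [hφ]
  -- On `[0, s]` the function `|y * L y|` is at most `s * M`, so a value above `t` forces `|X n i ω|
  -- ^ p ≥ s`.
  filter_upwards [eventually_ge_atTop (s * M)] with t ht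
  refine iSup_le fun n => ?_
  calc _ ≤ ∑ i, ENNReal.ofReal (a n i) * ∫⁻ ω, ENNReal.ofReal (φ |X n i ω|) ∂P := by
        refine Finset.sum_le_sum fun i _ => mul_le_mul_right ?_ _
        refine (setLIntegral_mono (g := fun ω => ENNReal.ofReal (φ |X n i ω|)) ?_
          fun ω hω => ?_).trans (setLIntegral_le_lintegral _ _)
        · exact (hφm.measurable.comp (hX n i).abs).ennreal_ofReal
        · have hω' : t < |(|X n i ω| ^ p * L (|X n i ω| ^ p))| := hω
          have hr : 0 ≤ |X n i ω| ^ p := Real.rpow_nonneg (abs_nonneg _) _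
          have hle : s ≤ |X n i ω| ^ p := by
            by_contra! hlt
            have h1 := hM _ ⟨hr, hlt.le⟩
            rw [abs_mul, abs_of_nonneg hr] at hω'
            exact absurd (mul_le_mul hlt.le h1 (abs_nonneg _) hs0) (by linarith)
          obtain ⟨h1, h2, -⟩ := hg _ hle
          rw [abs_of_pos h1, hφabs]
          exact ENNReal.ofReal_le_ofReal h2
    _ ≤ ENNReal.ofReal C₀ * ∫⁻ ω, ENNReal.ofReal (φ |Y ω|) ∂P' :=
        hdom.sum_lintegral_le hX ha hC₀ hC hY hφm (fun _ => hg0 _) n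
    _ ≤ _ := by
        refine mul_le_mul_right ?_ _
        rw [← lintegral_const_mul' _ _ ENNReal.ofNat_ne_top]
        refine lintegral_mono fun ω => ?_
        rw [hφabs]
        by_cases hle : s ≤ |Y ω| ^ p
        · obtain ⟨h1, -, h2⟩ := hg _ hle
          rw [indicator_of_mem (by exact hle), abs_of_pos h1]
          refine (ENNReal.ofReal_le_ofReal h2).trans ?_
          rw [ENNReal.ofReal_mul zero_le_two]
          simp
        · simp [hgs _ (not_le.1 hle)]
    _ ≤ ε := hsε

end Array

/-! ### Iterated logarithms and the dyadic integrability criterion -/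

theorem one_le_tlog (x : ℝ) : 1 ≤ tlog x := by
  rw [tlog, Real.le_logb_iff_rpow_le one_lt_two (lt_max_of_lt_left two_pos), Real.rpow_one]
  exact le_max_left _ _

theorem monotone_tlog : Monotone tlog := fun _ _ hxy =>
  Real.logb_le_logb_of_le one_lt_two (lt_max_of_lt_left two_pos) (max_le_max_left 2 hxy)

theorem one_le_iterate_tlog {j : ℕ} (hj : 1 ≤ j) (x : ℝ) : 1 ≤ tlog^[j] x := by
  obtain ⟨i, rfl⟩ := Nat.exists_eq_add_of_le' hj
  rw [Function.iterate_succ_apply']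
  exact one_le_tlog _

theorem one_le_logProdSq {ν : ℕ} (hν : 1 ≤ ν) (x : ℝ) : 1 ≤ logProdSq ν x :=
  one_le_mul_of_one_le_of_one_le
    (Finset.one_le_prod fun _ hj => one_le_iterate_tlog (Finset.mem_Icc.1 hj).1 x)
    (one_le_pow₀ (one_le_iterate_tlog hν x))

theorem monotone_logProdSq {ν : ℕ} (hν : 1 ≤ ν) : Monotone (logProdSq ν) := fun x y hxy => by
  have h0 : ∀ j, 1 ≤ j → ∀ z, 0 ≤ tlog^[j] z := fun j hj z =>
    zero_le_one.trans (one_le_iterate_tlog hj z)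
  refine mul_le_mul (Finset.prod_le_prod (fun j hj => h0 j (Finset.mem_Icc.1 hj).1 x)
    fun j _ => monotone_tlog.iterate j hxy)
    (pow_le_pow_left₀ (h0 ν hν x) (monotone_tlog.iterate ν hxy) 2) (sq_nonneg _)
    (Finset.prod_nonneg fun j hj => h0 j (Finset.mem_Icc.1 hj).1 y)

theorem logProdSq_one (x : ℝ) : logProdSq 1 x = tlog x ^ 2 := by simp [logProdSq]

theorem logProdSq_succ {ν : ℕ} (hν : 1 ≤ ν) (x : ℝ) :
    logProdSq (ν + 1) x = tlog x * logProdSq ν (tlog x) := by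
  obtain ⟨m, rfl⟩ := Nat.exists_eq_add_of_le' hν
  simp only [logProdSq, Nat.add_sub_cancel, ← Function.iterate_succ_apply]
  rw [← mul_assoc]
  congr 1
  rw [← Finset.Ico_add_one_right_eq_Icc, ← Finset.Ico_add_one_right_eq_Icc,
    Finset.prod_eq_prod_Ico_succ_bot (by omega)]
  congr 1
  rw [Finset.prod_Ico_add' (fun j => tlog^[j] x) 1 (m + 1) 1]

theorem tlog_two_pow {m : ℕ} (hm : 1 ≤ m) : tlog (2 ^ m) = m := by
  have : (2 : ℝ) ≤ 2 ^ m := le_self_pow₀ one_le_two (by omega)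
  rw [tlog, max_eq_right this, ← Real.rpow_natCast, Real.logb_rpow two_pos (by norm_num)]

/-- Since `tlog (2 ^ m) = m` for `m ≥ 1`, the series of level `ν + 1` is that of `1 / (m * logProdSq
ν m)`, and Cauchy condensation turns this into the series of level `ν`. Level 1 is the series of `1
/ m ^ 2`. -/
theorem summable_inv_logProdSq {ν : ℕ} (hν : 1 ≤ ν) :
    Summable fun m : ℕ => (logProdSq ν (2 ^ m))⁻¹ := by
  induction ν, hν using Nat.le_induction with
  | base =>
    -- The index 0 is dropped because `tlog (2 ^ 0) = 1`.
    rw [← summable_nat_add_iff 1]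
    have := (summable_nat_add_iff 1).2 (Real.summable_nat_pow_inv (p := 2).2 one_lt_two)
    refine this.congr fun m => ?_
    rw [logProdSq_one, tlog_two_pow (by omega)]
  | succ ν hν ih =>
    have hpos : ∀ x, 0 < logProdSq ν x := fun x => one_pos.trans_le (one_le_logProdSq hν x)
    have h1 : Summable fun m : ℕ => ((m : ℝ) * logProdSq ν m)⁻¹ := by
      rw [← summable_condensed_iff_of_nonneg]
      · refine ih.congr fun m => ?_
        push_cast
        rw [mul_inv, mul_inv_cancel_left₀ (by positivity)]
      · exact fun m => inv_nonneg.2 (mul_nonneg m.cast_nonneg (hpos _).le)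
      · intro m n hm hmn
        have hmn' : (m : ℝ) ≤ n := Nat.cast_le.2 hmn
        refine inv_anti₀ (mul_pos (Nat.cast_pos.2 hm) (hpos _)) ?_
        exact mul_le_mul hmn' (monotone_logProdSq hν hmn') (hpos _).le n.cast_nonneg
    rw [← summable_nat_add_iff 1] at h1 ⊢
    refine h1.congr fun m => ?_
    rw [logProdSq_succ hν, tlog_two_pow (by omega)]

/-- On each dyadic shell the integrand is at most a constant times its value at a nearby power of 2.
The tail bound cancels the factor `x ^ p * L (x ^ p)` there, leaving the series of `1 / logProdSq ν
(2 ^ m)`. -/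
theorem integrable_div_logProdSq {Ω : Type*} [MeasurableSpace Ω] {P : Measure Ω}
    [IsProbabilityMeasure P] {Y : Ω → ℝ} (hY : Measurable Y) {p : ℝ} (hp : 0 < p) {L : ℝ → ℝ}
    (hL : SlowlyVarying L) (hLmeas : Measurable ((Ici (0 : ℝ)).domRestrict L))
    (hLbdd : ∀ B : ℝ, ∃ M : ℝ, ∀ x ∈ Icc 0 B, |L x| ≤ M)
    {K x₀ : ℝ} (hK : ∀ x, x₀ ≤ x → x ^ p * L (x ^ p) * P.real {ω | x < |Y ω|} ≤ K)
    {ν : ℕ} (hν : 1 ≤ ν) :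
    Integrable (fun ω => |Y ω| ^ p * L (|Y ω| ^ p) * (logProdSq ν |Y ω|)⁻¹) P := by
  obtain ⟨B, hB, hpos, -, -, hgrow⟩ := hL.exists_almost_monotone
  have hℓ : ∀ x, 0 < logProdSq ν x := fun x => one_pos.trans_le (one_le_logProdSq hν x)
  have hr : ∀ ω, 0 ≤ |Y ω| ^ p := fun ω => Real.rpow_nonneg (abs_nonneg _) _
  have hmeas : Measurable fun ω => |Y ω| ^ p * L (|Y ω| ^ p) * (logProdSq ν |Y ω|)⁻¹ := by
    have h1 : Measurable fun ω => L (|Y ω| ^ p) :=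
      hLmeas.comp ((hY.abs.pow_const p).subtype_mk (h := fun ω => mem_Ici.2 (hr ω)))
    exact ((hY.abs.pow_const p).mul h1).mul
      ((monotone_logProdSq hν).measurable.comp hY.abs).inv
  refine ⟨hmeas.aestronglyMeasurable, ?_⟩
  -- The shell `[2 ^ j, 2 ^ (j + 1))` is compared with `2 ^ (j - 1)`, two doublings below its end,
  -- so that it lies in the strict tail event.
  obtain ⟨D, hD0, hD⟩ := hgrow ((4 : ℝ) ^ p) (by positivity)
  obtain ⟨N, hN⟩ : ∃ N : ℕ, ∀ m, N ≤ m → x₀ ≤ (2 : ℝ) ^ m ∧ B ≤ ((2 : ℝ) ^ m) ^ p := by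
    have ht : Tendsto (fun m : ℕ => (2 : ℝ) ^ m) atTop atTop :=
      tendsto_pow_atTop_atTop_of_one_lt one_lt_two
    exact eventually_atTop.1 ((ht.eventually_ge_atTop x₀).and
      (((tendsto_rpow_atTop hp).comp ht).eventually_ge_atTop B))
  obtain ⟨M, hM⟩ := hLbdd (((2 : ℝ) ^ (N + 1)) ^ p)
  set R : ℝ := ((2 : ℝ) ^ (N + 1)) ^ p with hR
  set c : ℕ → ℝ := fun m => D * (((2 : ℝ) ^ m) ^ p * L (((2 : ℝ) ^ m) ^ p)) *
    (logProdSq ν (2 ^ m))⁻¹ with hc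
  set S : ℕ → Set Ω := fun m => {ω | (2 : ℝ) ^ (m + N) < |Y ω|} with hS
  have hSm : ∀ m, MeasurableSet (S m) := fun m => measurableSet_lt measurable_const hY.abs
  have hptw : ∀ ω, ‖|Y ω| ^ p * L (|Y ω| ^ p) * (logProdSq ν |Y ω|)⁻¹‖ₑ ≤
      ENNReal.ofReal (R * M) +
        ∑' m, (S m).indicator (fun _ => ENNReal.ofReal (c (m + N))) ω := by
    intro ω
    rw [Real.enorm_eq_ofReal_abs, abs_mul, abs_of_pos (inv_pos.2 (hℓ _)), abs_mul,
      abs_of_nonneg (hr ω)]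
    rcases lt_or_ge |Y ω| (2 ^ (N + 1)) with hlt | hge
    · refine le_add_of_le_of_nonneg (ENNReal.ofReal_le_ofReal ?_) zero_le
      have hle : |Y ω| ^ p ≤ R := Real.rpow_le_rpow (abs_nonneg _) hlt.le hp.le
      refine (mul_le_of_le_one_right (mul_nonneg (hr ω) (abs_nonneg _))
        (inv_le_one_of_one_le₀ (one_le_logProdSq hν _))).trans ?_
      exact mul_le_mul hle (hM _ ⟨hr ω, hle⟩) (abs_nonneg _) ((hr ω).trans hle)
    · obtain ⟨j, hj1, hj2⟩ := exists_nat_pow_near (x := |Y ω|) (y := 2)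
        ((one_le_pow₀ one_le_two).trans hge) one_lt_two
      have hNj : N + 1 ≤ j := by
        by_contra! hlt
        exact absurd (hge.trans_lt hj2) (not_lt.2 (pow_le_pow_right₀ one_le_two (by omega)))
      obtain ⟨m, rfl⟩ : ∃ m, j = m + N + 1 := ⟨j - N - 1, by omega⟩
      have h2 : (2 : ℝ) ^ (m + N) < |Y ω| :=
        (pow_lt_pow_right₀ one_lt_two (by omega)).trans_le hj1
      refine le_trans ?_ (le_add_of_nonneg_left zero_le)
      refine le_trans ?_ (ENNReal.le_tsum m)
      rw [indicator_of_mem (by exact h2)]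
      refine ENNReal.ofReal_le_ofReal ?_
      have hb := (hN (m + N) (by omega)).2
      have hxy : ((2 : ℝ) ^ (m + N)) ^ p ≤ |Y ω| ^ p :=
        Real.rpow_le_rpow (by positivity) h2.le hp.le
      have h4 : |Y ω| ^ p ≤ 4 ^ p * ((2 : ℝ) ^ (m + N)) ^ p := by
        rw [← Real.mul_rpow (by norm_num) (by positivity)]
        refine Real.rpow_le_rpow (abs_nonneg _) (hj2.le.trans_eq ?_) hp.le
        ring
      rw [abs_of_pos (hpos _ (hb.trans hxy))]
      have h5 := hD _ _ hb hxy h4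
      have h6 : 0 < |Y ω| ^ p * L (|Y ω| ^ p) :=
        mul_pos (hB.trans_le (hb.trans hxy)) (hpos _ (hb.trans hxy))
      exact mul_le_mul h5 (inv_anti₀ (hℓ _) (monotone_logProdSq hν h2.le))
        (inv_pos.2 (hℓ _)).le (h6.le.trans h5)
  have hterm : ∀ m, ENNReal.ofReal (c (m + N)) * P (S m) ≤
      ENNReal.ofReal (D * K * (logProdSq ν (2 ^ (m + N)))⁻¹) := by
    intro m
    obtain ⟨h1, h2⟩ := hN (m + N) (by omega)
    have h3 := hK _ h1
    have h4 : 0 < ((2 : ℝ) ^ (m + N)) ^ p * L (((2 : ℝ) ^ (m + N)) ^ p) :=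
      mul_pos (hB.trans_le h2) (hpos _ h2)
    have h5 := hℓ (2 ^ (m + N))
    rw [← ofReal_measureReal, ← ENNReal.ofReal_mul (by positivity)]
    refine ENNReal.ofReal_le_ofReal ?_
    have h6 := mul_le_mul_of_nonneg_left h3 (mul_pos hD0 (inv_pos.2 h5)).le
    simp only [hc, hS]
    linarith
  have hsum : Summable fun m : ℕ => D * K * (logProdSq ν (2 ^ (m + N)))⁻¹ :=
    ((summable_nat_add_iff N).2 (summable_inv_logProdSq hν)).mul_left _
  calc _ ≤ ∫⁻ ω, (ENNReal.ofReal (R * M) +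
        ∑' m, (S m).indicator (fun _ => ENNReal.ofReal (c (m + N))) ω) ∂P := lintegral_mono hptw
    _ = ENNReal.ofReal (R * M) + ∑' m, ENNReal.ofReal (c (m + N)) * P (S m) := by
        rw [lintegral_add_left measurable_const, lintegral_tsum fun m =>
          (measurable_const.indicator (hSm m)).aemeasurable]
        simp [lintegral_indicator_const (hSm _)]
    _ ≤ ENNReal.ofReal (R * M) +
        ∑' m, ENNReal.ofReal (D * K * (logProdSq ν (2 ^ (m + N)))⁻¹) := by
        gcongr with m
        exact hterm m
    _ < ⊤ := ENNReal.add_lt_top.2 ⟨ENNReal.ofReal_lt_top, hsum.tsum_ofReal_lt_top⟩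

/-! ### The tail supremum and its law, for part (ii) -/

section Tail

variable {Ω : Type*} [MeasurableSpace Ω] {P : Measure Ω} [IsProbabilityMeasure P] {k : ℕ → ℕ}
  {X : (n : ℕ) → Fin (k n) → Ω → ℝ} {a : (n : ℕ) → Fin (k n) → ℝ} {C₀ : ℝ}

/-- Markov's inequality: for large `x`, almost monotonicity puts the transformed variable above `h /
2 > t` wherever `|X n i ω| > x`, where `h = x ^ p * L (x ^ p)`. Thus `h / 2` times the tail is at
most the expectation truncated at `t`. -/
theorem UniformlyIntegrable.tendsto_mul_tailSup {p : ℝ} (hp : 0 < p) {L : ℝ → ℝ}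
    (hL : SlowlyVarying L) (hX : ∀ n i, Measurable (X n i)) (ha : ∀ n i, 0 ≤ a n i)
    (hUI : UniformlyIntegrable P a (fun n i ω => |X n i ω| ^ p * L (|X n i ω| ^ p))) :
    Tendsto (fun x => x ^ p * L (x ^ p) * tailSup P a X x) atTop (𝓝 0) := by
  obtain ⟨B, hB, hpos, hmono, htop, -⟩ := hL.exists_almost_monotone
  have hxp : Tendsto (fun x : ℝ => x ^ p) atTop atTop := tendsto_rpow_atTop hp
  have hh0 : ∀ x, B ≤ x → 0 < x * L x := fun x hx => mul_pos (hB.trans_le hx) (hpos x hx)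
  rw [Metric.tendsto_nhds]
  intro ε hε
  obtain ⟨t, ht⟩ := (ENNReal.tendsto_nhds_zero.1 hUI (ENNReal.ofReal (ε / 4))
    (ENNReal.ofReal_pos.2 (by positivity))).exists
  filter_upwards [hxp.eventually_ge_atTop B, (htop.comp hxp).eventually_gt_atTop (2 * t),
    eventually_ge_atTop (0 : ℝ)] with x hx hxt hx0
  simp only [Function.comp] at hxt
  set h : ℝ := x ^ p * L (x ^ p) with hh
  have hhpos : 0 < h := hh0 _ hx
  have hT0 : 0 ≤ tailSup P a X x := tailSup_nonneg ha x
  have hT : tailSup P a X x ≤ (ε / 4) / (h / 2) := by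
    refine ciSup_le fun n => ?_
    rw [le_div_iff₀ (half_pos hhpos)]
    refine (ENNReal.ofReal_le_ofReal_iff (by positivity)).1 (le_trans ?_ ht)
    refine le_iSup_of_le n ?_
    rw [Finset.sum_mul, ENNReal.ofReal_sum_of_nonneg fun i _ =>
      mul_nonneg (mul_nonneg (ha n i) measureReal_nonneg) (half_pos hhpos).le]
    refine Finset.sum_le_sum fun i _ => ?_
    rw [mul_assoc, ENNReal.ofReal_mul (ha n i)]
    refine mul_le_mul_right ?_ _
    rw [mul_comm, ENNReal.ofReal_mul (half_pos hhpos).le, ofReal_measureReal,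
      ← setLIntegral_const]
    have hle : ∀ ω, x < |X n i ω| →
        h / 2 ≤ |(|X n i ω| ^ p * L (|X n i ω| ^ p))| := fun ω hω => by
      have h1 := hmono _ _ hx (Real.rpow_le_rpow hx0 hω.le hp.le)
      exact le_trans (by linarith) (le_abs_self _)
    have hsub : {ω | x < |X n i ω|} ⊆ {ω | t < |(|X n i ω| ^ p * L (|X n i ω| ^ p))|} :=
      fun ω hω => lt_of_lt_of_le (by linarith) (hle ω hω)
    exact (setLIntegral_mono' (measurableSet_lt measurable_const (hX n i).abs)
      fun ω hω => ENNReal.ofReal_le_ofReal (hle ω hω)).trans (lintegral_mono_set hsub)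
  rw [Real.dist_eq, sub_zero, abs_of_nonneg (mul_nonneg hhpos.le hT0)]
  rw [le_div_iff₀ (half_pos hhpos)] at hT
  linarith

theorem UniformlyIntegrable.tendsto_tailSup {p : ℝ} (hp : 0 < p) {L : ℝ → ℝ}
    (hL : SlowlyVarying L) (hX : ∀ n i, Measurable (X n i)) (ha : ∀ n i, 0 ≤ a n i)
    (hUI : UniformlyIntegrable P a (fun n i ω => |X n i ω| ^ p * L (|X n i ω| ^ p))) :
    Tendsto (tailSup P a X) atTop (𝓝 0) := by
  obtain ⟨-, -, -, -, htop, -⟩ := hL.exists_almost_monotone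
  have h1 := htop.comp (tendsto_rpow_atTop hp)
  have h2 := (tendsto_inv_atTop_zero.comp h1).mul (hUI.tendsto_mul_tailSup hp hL hX ha)
  rw [zero_mul] at h2
  refine h2.congr' ?_
  filter_upwards [h1.eventually_gt_atTop 0] with x hx
  exact inv_mul_cancel_left₀ hx.ne' _

theorem antitone_tailSup (ha : ∀ n i, 0 ≤ a n i) (hC : ∀ n, ∑ i, a n i ≤ C₀) :
    Antitone (tailSup P a X) := fun x y hxy =>
  ciSup_mono (bddAbove_tail ha hC x) fun n => Finset.sum_le_sum fun i _ =>
    mul_le_mul_of_nonneg_left (measureReal_mono fun _ hω => hxy.trans_lt hω) (ha n i)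

theorem tailSup_of_neg (hC : IsLUB (range fun n => ∑ i, a n i) C₀) {x : ℝ} (hx : x < 0) :
    tailSup P a X x = C₀ := by
  have h (n : ℕ) (i : Fin (k n)) : {ω | x < |X n i ω|} = univ :=
    eq_univ_of_forall fun ω => hx.trans_le (abs_nonneg _)
  simp only [tailSup, h, probReal_univ, mul_one]
  exact hC.ciSup_eq

/-- A supremum of right-continuous functions keeps the lower bound to the right of `x`; antitonicity
supplies the upper one. -/
theorem continuousWithinAt_tailSup (hX : ∀ n i, Measurable (X n i)) (ha : ∀ n i, 0 ≤ a n i)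
    (hC : ∀ n, ∑ i, a n i ≤ C₀) (x : ℝ) : ContinuousWithinAt (tailSup P a X) (Ici x) x := by
  have h1 (n : ℕ) : ContinuousWithinAt
      (fun x => ∑ i, a n i * P.real {ω | x < |X n i ω|}) (Ici x) x := by
    refine tendsto_finsetSum _ fun i _ => Tendsto.const_mul _ ?_
    have hm : Measurable fun ω => |X n i ω| := (hX n i).abs
    have : IsProbabilityMeasure (P.map fun ω => |X n i ω|) :=
      Measure.isProbabilityMeasure_map hm.aemeasurable
    have he (y : ℝ) : P.real {ω | y < |X n i ω|} = 1 - cdf (P.map fun ω => |X n i ω|) y := by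
      rw [cdf_eq_real, map_measureReal_apply hm measurableSet_Iic,
        ← probReal_compl_eq_one_sub (hm measurableSet_Iic)]
      congr 1
      ext ω
      simp
    simp only [he]
    exact ((cdf (P.map fun ω => |X n i ω|)).right_continuous x).const_sub 1
  refine tendsto_order.2 ⟨fun l hl => ?_, fun u hu => ?_⟩
  · obtain ⟨n, hn⟩ := exists_lt_of_lt_ciSup hl
    filter_upwards [(h1 n).eventually (lt_mem_nhds hn)] with y hy
    exact hy.trans_le (sum_le_tailSup ha hC y n)
  · filter_upwards [self_mem_nhdsWithin] with y hy
    exact (antitone_tailSup ha hC hy).trans_lt hu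

theorem exists_measure_of_tailSup (hX : ∀ n i, Measurable (X n i)) (ha : ∀ n i, 0 ≤ a n i)
    (hC₀ : 0 < C₀) (hC : IsLUB (range fun n => ∑ i, a n i) C₀)
    (hT : Tendsto (tailSup P a X) atTop (𝓝 0)) :
    ∃ μ : Measure ℝ, IsProbabilityMeasure μ ∧
      (∀ x, μ.real (Iic x) = 1 - 1 / C₀ * tailSup P a X x) ∧
      ∀ x, μ.real {y | x < |y|} = 1 / C₀ * tailSup P a X x := by
  have hC' : ∀ n, ∑ i, a n i ≤ C₀ := fun n => hC.1 (mem_range_self n)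
  have hpos : 0 < 1 / C₀ := one_div_pos.2 hC₀
  have hneg : ∀ x < 0, 1 - 1 / C₀ * tailSup P a X x = 0 := fun x hx => by
    rw [tailSup_of_neg hC hx, one_div_mul_cancel hC₀.ne', sub_self]
  let F : StieltjesFunction ℝ :=
    { toFun := fun x => 1 - 1 / C₀ * tailSup P a X x
      mono' := fun x y hxy => sub_le_sub_left
        (mul_le_mul_of_nonneg_left (antitone_tailSup ha hC' hxy) hpos.le) _
      right_continuous' := fun x =>
        ((continuousWithinAt_tailSup hX ha hC' x).const_mul (1 / C₀)).const_sub 1 }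
  have hF (x : ℝ) : F x = 1 - 1 / C₀ * tailSup P a X x := rfl
  have hbot : Tendsto F atBot (𝓝 0) := by
    refine tendsto_const_nhds.congr' ?_
    filter_upwards [eventually_lt_atBot 0] with x hx
    exact (hneg x hx).symm
  have htop : Tendsto F atTop (𝓝 1) := by
    have := (hT.const_mul (1 / C₀)).const_sub 1
    rwa [mul_zero, sub_zero] at this
  have hprob : IsProbabilityMeasure F.measure := F.isProbabilityMeasure hbot htop
  have hF0 (x : ℝ) : 0 ≤ F x := F.mono.le_of_tendsto hbot x
  have hnull : F.measure (Iio 0) = 0 := by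
    have hl : Function.leftLim F 0 = 0 := by
      refine leftLim_eq_of_tendsto (tendsto_const_nhds.congr' ?_)
      filter_upwards [self_mem_nhdsWithin] with x hx
      exact (hneg x hx).symm
    rw [F.measure_Iio hbot, hl, sub_zero, ENNReal.ofReal_zero]
  -- The law lives on `[0, ∞)`, so the tails of `|y|` and of `y` agree.
  have hae : ∀ᵐ y ∂F.measure, 0 ≤ y := by
    rw [ae_iff]
    simp only [not_le]
    exact hnull
  refine ⟨F.measure, hprob, fun x => ?_, fun x => ?_⟩
  · rw [measureReal_def, F.measure_Iic hbot, sub_zero, ENNReal.toReal_ofReal (hF0 x), hF]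
  · have he : F.measure.real {y | x < |y|} = F.measure.real (Ioi x) := by
      refine measureReal_congr ?_
      filter_upwards [hae] with y hy
      exact propext (show x < |y| ↔ x < y by rw [abs_of_nonneg hy])
    have h1 : 1 - F x = 1 / C₀ * tailSup P a X x := by rw [hF]; ring
    rw [he, measureReal_def, F.measure_Ioi htop, h1,
      ENNReal.toReal_ofReal (mul_nonneg hpos.le (tailSup_nonneg ha x))]

/-- Substitute `z = (x * L' x) ^ (1 / p)`: then `z ^ p * L (z ^ p)` is `x` times `L' x * L (x * L'
x)`, and the latter tends to 1. -/
theorem IsDeBruijnConjugate.tendsto_mul_comp {L L' : ℝ → ℝ} (hL' : IsDeBruijnConjugate L L')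
    {p : ℝ} (hp : 0 < p) {T : ℝ → ℝ}
    (hT : Tendsto (fun x => x ^ p * L (x ^ p) * T x) atTop (𝓝 0)) :
    Tendsto (fun x : ℝ => x * T (x ^ (1 / p) * L' x ^ (1 / p))) atTop (𝓝 0) := by
  obtain ⟨hsv, -, hconj⟩ := hL'
  obtain ⟨B, hB, hpos, -, htop, -⟩ := hsv.exists_almost_monotone
  have hz : Tendsto (fun x : ℝ => (x * L' x) ^ (1 / p)) atTop atTop :=
    (tendsto_rpow_atTop (one_div_pos.2 hp)).comp htop
  have h1 := (hT.comp hz).div hconj one_ne_zero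
  rw [zero_div] at h1
  refine h1.congr' ?_
  filter_upwards [eventually_ge_atTop B, hconj.eventually_ne one_ne_zero] with x hx hne
  have hx0 : 0 < x := hB.trans_le hx
  have hM := hpos x hx
  have h2 : ((x * L' x) ^ (1 / p)) ^ p = x * L' x := by
    rw [← Real.rpow_mul (mul_pos hx0 hM).le, one_div_mul_cancel hp.ne', Real.rpow_one]
  simp only [Pi.div_apply, Function.comp, h2]
  rw [← Real.mul_rpow hx0.le hM.le, div_eq_iff hne]
  ring

end Tail

end StochDom

/-! ### Assembly of both parts -/

theorem mainTheorem10 {Ω : Type*} [MeasurableSpace Ω] (P : Measure Ω)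
    [IsProbabilityMeasure P]
    (k : ℕ → ℕ) (hk : ∀ n, 0 < k n)
    (X : (n : ℕ) → Fin (k n) → Ω → ℝ) (hX : ∀ n i, Measurable (X n i))
    (a : (n : ℕ) → Fin (k n) → ℝ) (ha : ∀ n i, 0 ≤ a n i)
    (C₀ : ℝ) (hC₀ : 0 < C₀) (hsup : IsLUB (range fun n => ∑ i, a n i) C₀)
    (p : ℝ) (hp : 0 < p)
    (L L' : ℝ → ℝ) (hL : StochDom.SlowlyVarying L)
    (hLmeas : Measurable ((Ici (0 : ℝ)).domRestrict L))
    (hLbdd : ∀ B : ℝ, ∃ M : ℝ, ∀ x ∈ Icc 0 B, |L x| ≤ M)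
    (hL' : StochDom.IsDeBruijnConjugate L L') :
    (∀ (Ω' : Type*) [MeasurableSpace Ω'] (P' : Measure Ω') [IsProbabilityMeasure P']
        (Y : Ω' → ℝ), Measurable Y →
        StochDom.StochasticallyDominated P P' a C₀ X Y →
        Integrable (fun ω => |Y ω| ^ p * L (|Y ω| ^ p)) P' →
        StochDom.UniformlyIntegrable P a (fun n i ω => |X n i ω| ^ p * L (|X n i ω| ^ p))) ∧
    (StochDom.UniformlyIntegrable P a (fun n i ω => |X n i ω| ^ p * L (|X n i ω| ^ p)) →
      ∃ (Ω' : Type) (_ : MeasurableSpace Ω') (P' : Measure Ω') (_ : IsProbabilityMeasure P')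
        (Y : Ω' → ℝ), Measurable Y ∧
        (∀ x : ℝ, P'.real {ω | Y ω ≤ x} = 1 - (1 / C₀) * StochDom.tailSup P a X x) ∧
        StochDom.StochasticallyDominated P P' a C₀ X Y ∧
        (∀ ν : ℕ, 1 ≤ ν → Integrable
          (fun ω => |Y ω| ^ p * L (|Y ω| ^ p) * (StochDom.logProdSq ν |Y ω|)⁻¹) P') ∧
        Tendsto (fun x : ℝ => x * P'.real {ω | x ^ (1 / p) * L' x ^ (1 / p) < |Y ω|})
          atTop (𝓝 0)) := by

  have hC : ∀ n, ∑ i, a n i ≤ C₀ := fun n => hsup.1 (mem_range_self n)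
  refine ⟨fun Ω' _ P' _ Y hY hdom hint =>
    hdom.uniformlyIntegrable hX ha hC₀.le hC hY hp hL hLbdd hint, fun hUI => ?_⟩
  have hlim := hUI.tendsto_mul_tailSup hp hL hX ha
  obtain ⟨μ, hμ, hcdf, htail⟩ :=
    StochDom.exists_measure_of_tailSup hX ha hC₀ hsup (hUI.tendsto_tailSup hp hL hX ha)
  have hlim' : Tendsto (fun x : ℝ => x ^ p * L (x ^ p) * μ.real {y | x < |y|}) atTop (𝓝 0) := by
    have h1 := hlim.const_mul (1 / C₀)
    rw [mul_zero] at h1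
    refine h1.congr fun x => ?_
    rw [htail]
    ring
  -- The dominating variable is the identity on `ℝ` under the constructed law.
  refine ⟨ℝ, inferInstance, μ, hμ, id, measurable_id, hcdf, fun x => ?_, fun ν hν => ?_,
    hL'.tendsto_mul_comp hp (T := fun x => μ.real {y | x < |y|}) hlim'⟩
  · simp only [id, htail]
    rw [← mul_assoc, mul_one_div_cancel hC₀.ne', one_mul]
  · obtain ⟨x₀, hx₀⟩ := eventually_atTop.1 (hlim'.eventually (gt_mem_nhds one_pos))
    exact StochDom.integrable_div_logProdSq measurable_id hp hL hLmeas hLbdd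
      (fun x hx => (hx₀ x hx).le) hν
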